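/- Let $m\ge 1$ be an integer, let $\mu\in\mathbb R$, and let $w\in C^2(0,\infty)$ be a positive solution of $$-w''-\frac1r w'+\frac{m^2}{r^2}w+r^2w+2|w|^2w-2\mu w=0,\qquad r>0,$$ such that $w$ is bounded as $r\to0^+$ and $w(r)\to0$ as $r\to\infty$ (the radial profile of the vortex solution $\psi(t,r,\theta)=e^{-i\mu t}e^{im\theta}w(r)$ of the Gross-Pitaevskii equation $i\psi_t=-\frac12\Delta\psi+\frac12r^2\psi+|\psi|^2\psi$ on $\mathbb R^2$). Let $$J=\begin{pmatrix}0&-1\\1&0\end{pmatrix},\qquad R=\begin{pmatrix}1&0\\0&-1\end{pmatrix},\qquad L_w=2|w(r)|^2I+|w(r)|^2e^{2m\theta J}R-\mu I ,$$ where $(r,\theta)$ are polar coordinates on $\mathbb R^2$, and let $L_c=-\frac12\Delta+\frac12r^2$ be the self-adjoint operator in $L^2(\mathbb R^2,\mathbb C^2)$ associated with the closed quadratic form $$q(\Psi)=\int_{\mathbb R^2}\Big(\tfrac12|\nabla\Psi|^2+\tfrac{r^2}{2}|\Psi|^2\Big)\,dx,\qquad \Psi\in H^1(\mathbb R^2,\mathbb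 C^2)\cap L^2(\mathbb R^2,\mathbb C^2;r^2).$$ Let $A=-J(L_c+L_w)$ with domain $D(A)=D(L_c)$ be the linearization about the vortex. Then $\max_{r>0}|w(r)|^2$ exists, it satisfies $$3\max_{r>0}|w(r)|^2<3(\mu-m),$$ and every eigenvalue $\lambda\in\mathbb C$ of $A$ satisfies $$|\operatorname{Re}\lambda|<3\max_{r>0}|w(r)|^2 .$$ -/

import Mathlib

open MeasureTheory Filter Topology Set
open scoped ContDiff

noncomputable section

namespace GPVortex

/-! ### Vortex profiles -/

/-- `w` is a positive, spatially localized radial vortex profile of degree `m` and frequency `μ`.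
Only the values `w r` with `r > 0` matter. -/
structure IsVortexProfile (m : ℕ) (μ : ℝ) (w : ℝ → ℝ) : Prop where
  contDiffOn : ContDiffOn ℝ 2 w (Ioi 0)
  ode : ∀ r : ℝ, 0 < r →
    -(deriv (deriv w) r) - 1 / r * deriv w r + (m : ℝ) ^ 2 / r ^ 2 * w r + r ^ 2 * w r
      + 2 * |w r| ^ 2 * w r - 2 * μ * w r = 0
  pos : ∀ r : ℝ, 0 < r → 0 < w r
  bounded_zero : ∃ C : ℝ, ∀ᶠ r in 𝓝[>] (0 : ℝ), |w r| ≤ C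
  tendsto_zero : Tendsto w atTop (𝓝 0)

/-! ### The Hilbert space -/

/-- The plane. -/
abbrev Plane : Type := EuclideanSpace ℝ (Fin 2)

/-- The target `ℂ²`. -/
abbrev C2 : Type := EuclideanSpace ℂ (Fin 2)

/-- The complex Hilbert space `L²(ℝ², ℂ²)` for Lebesgue measure. -/
abbrev L2 : Type := Lp C2 2 (volume : Measure Plane)

/-- The action of a complex `2 × 2` matrix on `ℂ²`. -/
abbrev act (M : Matrix (Fin 2) (Fin 2) ℂ) : C2 →L[ℂ] C2 := Matrix.toEuclideanCLM (𝕜 := ℂ) M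

theorem coe_zero_ae : ∀ᵐ x ∂(volume : Measure Plane), (0 : L2) x = 0 :=
  Lp.coeFn_zero C2 2 (volume : Measure Plane)

theorem coe_add_ae (u v : L2) :
    ∀ᵐ x ∂(volume : Measure Plane), (u + v : L2) x = u x + v x :=
  Lp.coeFn_add u v

theorem coe_smul_ae (c : ℂ) (u : L2) :
    ∀ᵐ x ∂(volume : Measure Plane), (c • u : L2) x = c • u x :=
  Lp.coeFn_smul c u

/-- All `u` in `L²(ℝ², ℂ²)` for which `x ↦ M x u(x)` is again square integrable. -/
def mulDomain (M : Plane → Matrix (Fin 2) (Fin 2) ℂ) : Submodule ℂ L2 where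
  carrier := {u | MemLp (fun x => act (M x) (u x)) 2 volume}
  zero_mem' := by
    refine MemLp.ae_eq (f := fun _ => (0 : C2)) ?_ MemLp.zero'
    filter_upwards [coe_zero_ae] with x hx
    rw [hx, map_zero]
  add_mem' := by
    intro u v hu hv
    refine MemLp.ae_eq ?_ (MemLp.add hu hv)
    filter_upwards [coe_add_ae u v] with x hx
    rw [hx, map_add, Pi.add_apply]
  smul_mem' := by
    intro c u hu
    refine MemLp.ae_eq ?_ (MemLp.const_smul hu c)
    filter_upwards [coe_smul_ae c u] with x hx
    rw [hx, map_smul, Pi.smul_apply]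

/-- The maximal operator of multiplication by a matrix-valued function on `L²(ℝ², ℂ²)`. -/
def mulOp (M : Plane → Matrix (Fin 2) (Fin 2) ℂ) : L2 →ₗ.[ℂ] L2 where
  domain := mulDomain M
  toFun :=
    { toFun := fun u => MemLp.toLp (fun x => act (M x) ((u : L2) x)) u.2
      map_add' := by
        intro u v
        rw [← MemLp.toLp_add u.2 v.2]
        refine (MemLp.toLp_eq_toLp_iff _ _).2 ?_
        filter_upwards [coe_add_ae (u : L2) (v : L2)] with x hx
        rw [Submodule.coe_add, hx, map_add, Pi.add_apply]
      map_smul' := by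
        intro c u
        rw [RingHom.id_apply, ← MemLp.toLp_const_smul c u.2]
        refine (MemLp.toLp_eq_toLp_iff _ _).2 ?_
        filter_upwards [coe_smul_ae c (u : L2)] with x hx
        rw [Submodule.coe_smul, hx, map_smul, Pi.smul_apply] }

/-! ### Weak derivatives -/

/-- The `k`-th classical partial derivative of a scalar function on the plane. -/
def partialDeriv (k : Fin 2) (φ : Plane → ℝ) (x : Plane) : ℝ :=
  fderiv ℝ φ x (EuclideanSpace.single k 1)

theorem testDeriv_continuous (k : Fin 2) {φ : Plane → ℝ} (hφ : ContDiff ℝ ∞ φ) :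
    Continuous (partialDeriv k φ) :=
  (hφ.continuous_fderiv (by simp)).clm_apply continuous_const

theorem testDeriv_compact (k : Fin 2) {φ : Plane → ℝ} (hc : HasCompactSupport φ) :
    HasCompactSupport (partialDeriv k φ) :=
  hc.fderiv_apply ℝ _

theorem integrable_test_smul {φ : Plane → ℝ} (hφ : Continuous φ) (hc : HasCompactSupport φ)
    (u : L2) : Integrable (fun x => φ x • u x) volume :=
  ((Lp.memLp u).locallyIntegrable (by norm_num)).integrable_smul_left_of_hasCompactSupport hφ hc

/-- The graph of the `k`-th weak derivative in `L²(ℝ², ℂ²)`: pairs `(u, g)` such that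
`∫ (∂ₖ φ) u = - ∫ φ g` for every test function `φ`. -/
def weakPartialGraph (k : Fin 2) : Submodule ℂ (L2 × L2) where
  carrier := {p | ∀ φ : Plane → ℝ, ContDiff ℝ ∞ φ → HasCompactSupport φ →
    ∫ x, partialDeriv k φ x • p.1 x = -∫ x, φ x • p.2 x}
  zero_mem' := by
    intro φ _ _
    have h0 : ∀ ψ : Plane → ℝ, ∫ x, ψ x • ((0 : L2) x) = 0 := by
      intro ψ
      refine (integral_congr_ae (g := fun _ => (0 : C2)) ?_).trans (by simp)
      filter_upwards [coe_zero_ae] with x hx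
      rw [hx, smul_zero]
    exact (h0 _).trans (neg_eq_zero.2 (h0 φ)).symm
  add_mem' := by
    rintro ⟨u, g⟩ ⟨v, h⟩ hp hq φ hφ hc
    have hadd : ∀ ψ : Plane → ℝ, Continuous ψ → HasCompactSupport ψ → ∀ a b : L2,
        ∫ x, ψ x • ((a + b : L2) x) = (∫ x, ψ x • a x) + ∫ x, ψ x • b x := by
      intro ψ hψ hψc a b
      rw [← integral_add (integrable_test_smul hψ hψc a) (integrable_test_smul hψ hψc b)]
      refine integral_congr_ae ?_
      filter_upwards [coe_add_ae a b] with x hx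
      rw [hx, smul_add]
    have h1 := hp φ hφ hc
    have h2 := hq φ hφ hc
    simp only [Prod.mk_add_mk] at h1 h2 ⊢
    rw [hadd _ (testDeriv_continuous k hφ) (testDeriv_compact k hc),
      hadd _ hφ.continuous hc, h1, h2]
    abel
  smul_mem' := by
    rintro c ⟨u, g⟩ hp φ hφ hc
    have hsmul : ∀ ψ : Plane → ℝ, ∀ a : L2,
        ∫ x, ψ x • ((c • a : L2) x) = c • ∫ x, ψ x • a x := by
      intro ψ a
      rw [← integral_smul]
      refine integral_congr_ae ?_
      filter_upwards [coe_smul_ae c a] with x hx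
      rw [hx]
      exact smul_comm _ _ _
    have h1 := hp φ hφ hc
    simp only [Prod.smul_mk] at h1 ⊢
    rw [hsmul, hsmul, h1, smul_neg]

/-- An `L²` function has at most one weak derivative in `L²`. -/
theorem weakPartialGraph_unique (k : Fin 2) (p : L2 × L2) (hp : p ∈ weakPartialGraph k)
    (h0 : p.1 = 0) : p.2 = 0 := by
  have hz : ∀ᵐ x ∂(volume : Measure Plane), p.2 x = 0 := by
    refine ae_eq_zero_of_integral_contDiff_smul_eq_zero
      ((Lp.memLp p.2).locallyIntegrable (by norm_num)) ?_
    intro φ hφ hc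
    have h1 := hp φ hφ hc
    have h2 : ∫ x, partialDeriv k φ x • p.1 x = 0 := by
      rw [h0]
      refine (integral_congr_ae (g := fun _ => (0 : C2)) ?_).trans (by simp)
      filter_upwards [coe_zero_ae] with x hx
      rw [hx, smul_zero]
    rw [h2] at h1
    exact neg_eq_zero.1 h1.symm
  exact (Lp.eq_zero_iff_ae_eq_zero).2 hz

/-- The `k`-th weak derivative `∂ₖ` as an unbounded operator in `L²(ℝ², ℂ²)`. -/
def weakPartial (k : Fin 2) : L2 →ₗ.[ℂ] L2 := (weakPartialGraph k).toLinearPMap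

theorem weakPartial_graph (k : Fin 2) : (weakPartial k).graph = weakPartialGraph k :=
  Submodule.toLinearPMap_graph_eq _ (weakPartialGraph_unique k)

/-! ### The harmonic oscillator, defined through its quadratic form -/

/-- Multiplication by `|x|`, with domain `L²(ℝ², ℂ²) ∩ L²(ℝ², ℂ²; r²)`. -/
def radiusOp : L2 →ₗ.[ℂ] L2 := mulOp fun x => ((‖x‖ : ℝ) : ℂ) • (1 : Matrix (Fin 2) (Fin 2) ℂ)

/-- The form domain `H¹(ℝ², ℂ²) ∩ L²(ℝ², ℂ²; r²)`. -/
def formDomain : Submodule ℂ L2 :=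
  (⨅ k : Fin 2, (weakPartial k).domain) ⊓ radiusOp.domain

/-- `∂ₖ u` for `u` in the form domain. -/
def gradOn (k : Fin 2) : formDomain →ₗ[ℂ] L2 :=
  (weakPartial k).toFun ∘ₗ
    Submodule.inclusion (inf_le_left.trans (iInf_le (fun k => (weakPartial k).domain) k))

/-- `|x| u` for `u` in the form domain. -/
def radiusOn : formDomain →ₗ[ℂ] L2 := radiusOp.toFun ∘ₗ Submodule.inclusion inf_le_right

/-- The sesquilinear form (conjugate linear in the first variable)
`q(v, u) = ∫ ½ ∇v · ∇u + ½ r² v · u`. -/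
def trapForm (v u : formDomain) : ℂ :=
  (1 / 2 : ℂ) * ∑ k : Fin 2, inner ℂ (gradOn k v) (gradOn k u)
    + (1 / 2 : ℂ) * inner ℂ (radiusOn v) (radiusOn u)

/-- The graph of the operator associated with the form `q`: pairs `(u, f)` with `u` in the form
domain and `q(v, u) = ⟨v, f⟩` for all `v` in the form domain. -/
def LcGraph : Submodule ℂ (L2 × L2) where
  carrier := {p | ∃ h : p.1 ∈ formDomain,
    ∀ v : formDomain, trapForm v ⟨p.1, h⟩ = inner ℂ (v : L2) p.2}
  zero_mem' := by
    refine ⟨formDomain.zero_mem, fun v => ?_⟩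
    have : (⟨(0 : L2 × L2).1, formDomain.zero_mem⟩ : formDomain) = 0 := rfl
    rw [this]
    simp [trapForm]
  add_mem' := by
    rintro ⟨u, f⟩ ⟨u', f'⟩ ⟨h, hu⟩ ⟨h', hu'⟩
    refine ⟨formDomain.add_mem h h', fun v => ?_⟩
    have e : (⟨((u, f) + (u', f') : L2 × L2).1, formDomain.add_mem h h'⟩ : formDomain)
        = ⟨u, h⟩ + ⟨u', h'⟩ := rfl
    have a := hu v
    have b := hu' v
    rw [e]
    simp only [Prod.mk_add_mk, inner_add_right] at a b ⊢
    rw [← a, ← b]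
    simp only [trapForm, map_add, inner_add_right, Finset.sum_add_distrib]
    ring
  smul_mem' := by
    rintro c ⟨u, f⟩ ⟨h, hu⟩
    refine ⟨formDomain.smul_mem c h, fun v => ?_⟩
    have e : (⟨(c • (u, f) : L2 × L2).1, formDomain.smul_mem c h⟩ : formDomain)
        = c • ⟨u, h⟩ := rfl
    have a := hu v
    rw [e]
    simp only [Prod.smul_mk, inner_smul_right] at a ⊢
    rw [← a]
    simp only [trapForm, map_smul, inner_smul_right, ← Finset.mul_sum]
    ring

/-- The test field `φ c` with `φ` a scalar test function and `c ∈ ℂ²`, as an element of `L²`. -/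
theorem memLp_test {φ : Plane → ℝ} (hφ : Continuous φ) (hc : HasCompactSupport φ) (c : C2) :
    MemLp (fun x => φ x • c) 2 (volume : Measure Plane) :=
  (hφ.smul continuous_const).memLp_of_hasCompactSupport hc.smul_right

/-- Test fields belong to the form domain. -/
theorem test_mem_formDomain {φ : Plane → ℝ} (hφ : ContDiff ℝ ∞ φ) (hc : HasCompactSupport φ)
    (c : C2) : (memLp_test hφ.continuous hc c).toLp _ ∈ formDomain := by
  refine Submodule.mem_inf.2 ⟨(Submodule.mem_iInf _).2 fun k => ?_, ?_⟩
  · have hd := memLp_test (testDeriv_continuous k hφ) (testDeriv_compact k hc) c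
    refine Submodule.mem_map.2
      ⟨((memLp_test hφ.continuous hc c).toLp _, hd.toLp _), ?_, rfl⟩
    intro ψ hψ hψc
    have e1 : ∫ x, partialDeriv k ψ x • ((memLp_test hφ.continuous hc c).toLp _ : L2) x
        = ∫ x, (partialDeriv k ψ x * φ x) • c := by
      refine integral_congr_ae ?_
      filter_upwards [(memLp_test hφ.continuous hc c).coeFn_toLp] with x hx
      rw [hx, smul_smul]
    have e2 : ∫ x, ψ x • (hd.toLp _ : L2) x = ∫ x, (ψ x * partialDeriv k φ x) • c := by
      refine integral_congr_ae ?_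
      filter_upwards [hd.coeFn_toLp] with x hx
      rw [hx, smul_smul]
    change ∫ x, partialDeriv k ψ x • ((memLp_test hφ.continuous hc c).toLp _ : L2) x
        = -∫ x, ψ x • (hd.toLp _ : L2) x
    rw [e1, e2, integral_smul_const, integral_smul_const, ← neg_smul]
    congr 1
    have i1 : Integrable (fun x => partialDeriv k ψ x * φ x) volume :=
      ((testDeriv_continuous k hψ).mul hφ.continuous).integrable_of_hasCompactSupport
        (hc.mul_left)
    have i2 : Integrable (fun x => ψ x * partialDeriv k φ x) volume :=
      (hψ.continuous.mul (testDeriv_continuous k hφ)).integrable_of_hasCompactSupport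
        (hψc.mul_right)
    have i3 : Integrable (fun x => ψ x * φ x) volume :=
      (hψ.continuous.mul hφ.continuous).integrable_of_hasCompactSupport (hψc.mul_right)
    have key := integral_mul_fderiv_eq_neg_fderiv_mul_of_integrable (𝕜 := ℝ)
      (v := (EuclideanSpace.single k 1 : Plane)) i1 i2 i3
      (fun x _ => (hψ.differentiable (by simp)) x) (fun x _ => (hφ.differentiable (by simp)) x)
    simp only [partialDeriv] at key ⊢
    rw [key, neg_neg]
  · have hr : MemLp (fun x : Plane => ‖x‖ • (φ x • c)) 2 volume :=
      (continuous_norm.smul (hφ.continuous.smul continuous_const)).memLp_of_hasCompactSupport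
        (hc.smul_right.smul_left)
    change MemLp _ 2 volume
    refine MemLp.ae_eq ?_ hr
    filter_upwards [(memLp_test hφ.continuous hc c).coeFn_toLp] with x hx
    have e : act (((‖x‖ : ℝ) : ℂ) • (1 : Matrix (Fin 2) (Fin 2) ℂ)) (φ x • c)
        = ‖x‖ • (φ x • c) := by
      have e1 : act (((‖x‖ : ℝ) : ℂ) • (1 : Matrix (Fin 2) (Fin 2) ℂ))
          = ((‖x‖ : ℝ) : ℂ) • (1 : C2 →L[ℂ] C2) := by
        change Matrix.toEuclideanCLM (𝕜 := ℂ) _ = _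
        rw [_root_.map_smul (Matrix.toEuclideanCLM (n := Fin 2) (𝕜 := ℂ)),
          map_one (Matrix.toEuclideanCLM (n := Fin 2) (𝕜 := ℂ))]
      rw [e1]
      exact Complex.coe_smul _ _
    rw [hx, e]

/-- The form domain is dense, so the operator associated with the form is single-valued. -/
theorem LcGraph_unique (p : L2 × L2) (hp : p ∈ LcGraph) (h0 : p.1 = 0) : p.2 = 0 := by
  obtain ⟨h, hq⟩ := hp
  have e : (⟨p.1, h⟩ : formDomain) = 0 := Subtype.ext h0
  have hq0 : ∀ v : formDomain, inner ℂ (v : L2) p.2 = 0 := by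
    intro v
    rw [← hq v, e]
    simp [trapForm]
  have hz : ∀ᵐ x ∂(volume : Measure Plane), p.2 x = 0 := by
    refine ae_eq_zero_of_integral_contDiff_smul_eq_zero
      ((Lp.memLp p.2).locallyIntegrable (by norm_num)) ?_
    intro φ hφ hc
    refine ext_inner_left ℂ fun c => ?_
    rw [inner_zero_right, ← integral_inner (integrable_test_smul hφ.continuous hc p.2)]
    have := hq0 ⟨_, test_mem_formDomain hφ hc c⟩
    rw [L2.inner_def] at this
    rw [← this]
    refine integral_congr_ae ?_
    filter_upwards [(memLp_test hφ.continuous hc c).coeFn_toLp] with x hx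
    rw [hx, inner_smul_right_eq_smul, inner_smul_left_eq_smul]
  exact (Lp.eq_zero_iff_ae_eq_zero).2 hz

/-- The self-adjoint operator `L_c = -½ Δ + ½ r²` on `L²(ℝ², ℂ²)`, i.e. the operator associated
with the closed, densely defined, non-negative quadratic form `q`. -/
def Lc : L2 →ₗ.[ℂ] L2 := LcGraph.toLinearPMap

theorem Lc_graph : Lc.graph = LcGraph := Submodule.toLinearPMap_graph_eq _ LcGraph_unique

/-! ### The linearization about a vortex -/

/-- The matrix `J`. -/
def matJ : Matrix (Fin 2) (Fin 2) ℂ := !![0, -1; 1, 0]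

/-- The matrix `R`. -/
def matR : Matrix (Fin 2) (Fin 2) ℂ := !![1, 0; 0, -1]

/-- The rotation matrix `e^{tJ}`. -/
def rot (t : ℝ) : Matrix (Fin 2) (Fin 2) ℂ :=
  !![(Real.cos t : ℂ), -(Real.sin t : ℂ); (Real.sin t : ℂ), (Real.cos t : ℂ)]

/-- The polar angle `θ` of a point of the plane. -/
def angle (x : Plane) : ℝ := Complex.arg ⟨x 0, x 1⟩

/-- The matrix-valued potential `2 |w|² I + |w|² e^{2mθJ} R - μ I`. -/
def potential (m : ℕ) (μ : ℝ) (w : ℝ → ℝ) (x : Plane) : Matrix (Fin 2) (Fin 2) ℂ :=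
  ((2 * |w ‖x‖| ^ 2 : ℝ) : ℂ) • (1 : Matrix (Fin 2) (Fin 2) ℂ)
    + ((|w ‖x‖| ^ 2 : ℝ) : ℂ) • (rot (2 * m * angle x) * matR)
    - (μ : ℂ) • (1 : Matrix (Fin 2) (Fin 2) ℂ)

/-- The multiplication operator `L_w`; for a vortex profile `w` it is everywhere defined. -/
def Lw (m : ℕ) (μ : ℝ) (w : ℝ → ℝ) : L2 →ₗ.[ℂ] L2 := mulOp (potential m μ w)

/-- A vortex profile is bounded. -/
theorem IsVortexProfile.bounded {m : ℕ} {μ : ℝ} {w : ℝ → ℝ} (hw : IsVortexProfile m μ w) :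
    ∃ C : ℝ, ∀ r : ℝ, 0 < r → |w r| ≤ C := by
  obtain ⟨C₁, h₁⟩ := hw.bounded_zero
  obtain ⟨a, ha, h₁⟩ := (mem_nhdsGT_iff_exists_Ioo_subset).1 h₁
  have h₂ : ∀ᶠ r in atTop, |w r| < 1 := by
    have := hw.tendsto_zero.abs
    rw [abs_zero] at this
    exact this.eventually_lt_const one_pos
  obtain ⟨b, h₂⟩ := eventually_atTop.1 h₂
  have hsub : Icc a b ⊆ Ioi (0 : ℝ) := fun r hr => lt_of_lt_of_le ha hr.1
  obtain ⟨C₃, h₃⟩ := (isCompact_Icc (a := a) (b := b)).exists_bound_of_continuousOn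
    (hw.contDiffOn.continuousOn.mono hsub)
  refine ⟨max C₁ (max 1 C₃), fun r hr => ?_⟩
  rcases lt_or_ge r a with h | h
  · exact le_max_of_le_left (h₁ ⟨hr, h⟩)
  · rcases le_or_gt b r with h' | h'
    · exact le_max_of_le_right (le_max_of_le_left (h₂ r h').le)
    · exact le_max_of_le_right (le_max_of_le_right (h₃ r ⟨h, h'.le⟩))

theorem mulDomain_eq_top {M : Plane → Matrix (Fin 2) (Fin 2) ℂ} (C : ℝ)
    (hM : AEStronglyMeasurable (fun x => act (M x)) (volume : Measure Plane))
    (hC : ∀ᵐ x ∂(volume : Measure Plane), ‖act (M x)‖ ≤ C) : mulDomain M = ⊤ := by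
  refine (Submodule.eq_top_iff').2 fun u => ?_
  change MemLp _ 2 volume
  refine MemLp.of_le_mul (c := C) (Lp.memLp u)
    ((ContinuousLinearMap.id ℂ (C2 →L[ℂ] C2)).aestronglyMeasurable_comp₂ hM
      (Lp.aestronglyMeasurable u)) ?_
  filter_upwards [hC] with x hx
  exact (ContinuousLinearMap.le_opNorm _ _).trans
    (mul_le_mul_of_nonneg_right hx (norm_nonneg _))

/-- For a vortex profile, `L_w` is defined on all of `L²(ℝ², ℂ²)`. -/
theorem Lw_domain {m : ℕ} {μ : ℝ} {w : ℝ → ℝ} (hw : IsVortexProfile m μ w) :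
    (Lw m μ w).domain = ⊤ := by
  obtain ⟨C, hC⟩ := hw.bounded
  set v : ℝ → ℝ := (Ioi (0 : ℝ)).indicator w with hv
  have hvm : Measurable v :=
    (hw.contDiffOn.continuousOn.measurable_piecewise continuousOn_const measurableSet_Ioi)
  have hvb : ∀ r, |v r| ^ 2 ≤ C ^ 2 := by
    intro r
    by_cases hr : r ∈ Ioi (0 : ℝ)
    · rw [hv, indicator_of_mem hr]
      exact pow_le_pow_left₀ (abs_nonneg _) (hC r hr) 2
    · rw [hv, indicator_of_notMem hr]
      simpa using sq_nonneg C
  have hm : Measurable fun x : Plane => |v ‖x‖| ^ 2 :=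
    ((hvm.comp measurable_norm).abs).pow_const 2
  have hang : Measurable angle := by
    refine Complex.measurable_arg.comp ?_
    have : (fun x : Plane => (⟨x 0, x 1⟩ : ℂ)) = fun x : Plane => (x 0 : ℂ) + (x 1 : ℂ) * Complex.I :=
      funext fun x => Complex.mk_eq_add_mul_I _ _
    rw [this]
    fun_prop
  set P : Matrix (Fin 2) (Fin 2) ℂ := !![1, 0; 0, -1]
  set Q : Matrix (Fin 2) (Fin 2) ℂ := !![0, 1; 1, 0]
  let F : Plane → (C2 →L[ℂ] C2) := fun x =>
    ((2 * |v ‖x‖| ^ 2 - μ : ℝ) : ℂ) • act 1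
      + ((|v ‖x‖| ^ 2 * Real.cos (2 * m * angle x) : ℝ) : ℂ) • act P
      + ((|v ‖x‖| ^ 2 * Real.sin (2 * m * angle x) : ℝ) : ℂ) • act Q
  have hF : ∀ᵐ x ∂(volume : Measure Plane), F x = act (potential m μ w x) := by
    have h0 : ∀ᵐ x ∂(volume : Measure Plane), x ≠ 0 := by
      simp [ae_iff]
    filter_upwards [h0] with x hx
    have e : v ‖x‖ = w ‖x‖ := indicator_of_mem (mem_Ioi.2 (norm_pos_iff.2 hx)) _
    simp only [F, act, ← map_smul, ← map_add, e]
    congr 1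
    ext i j
    fin_cases i <;> fin_cases j <;>
      simp [potential, rot, matR, P, Q] <;> ring
  refine mulDomain_eq_top
    ((2 * C ^ 2 + |μ|) * ‖act 1‖ + C ^ 2 * ‖act P‖ + C ^ 2 * ‖act Q‖) ?_ ?_
  · refine AEStronglyMeasurable.congr ?_ hF
    refine Measurable.aestronglyMeasurable ?_
    fun_prop
  · filter_upwards [hF] with x hx
    rw [← hx]
    have h1 := hvb ‖x‖
    have h0 : 0 ≤ |v ‖x‖| ^ 2 := by positivity
    refine (norm_add₃_le).trans ?_
    simp only [norm_smul, Complex.norm_real, Real.norm_eq_abs]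
    gcongr
    · refine (abs_sub _ _).trans ?_
      rw [abs_of_nonneg (by positivity : 0 ≤ 2 * |v ‖x‖| ^ 2)]
      linarith
    · rw [abs_mul, abs_of_nonneg h0]
      exact (mul_le_of_le_one_right h0 (Real.abs_cos_le_one _)).trans h1
    · rw [abs_mul, abs_of_nonneg h0]
      exact (mul_le_of_le_one_right h0 (Real.abs_sin_le_one _)).trans h1

/-- The linearized operator `A = -J (L_c + L_w)` in `L²(ℝ², ℂ²)`. -/
def linearization (m : ℕ) (μ : ℝ) (w : ℝ → ℝ) : L2 →ₗ.[ℂ] L2 :=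
  ((act (-matJ)).compLpL 2 (volume : Measure Plane)).toLinearMap.compPMap (Lc + Lw m μ w)

/-- For a vortex profile, `D(A) = D(L_c)`. -/
theorem linearization_domain {m : ℕ} {μ : ℝ} {w : ℝ → ℝ} (hw : IsVortexProfile m μ w) :
    (linearization m μ w).domain = Lc.domain := by
  change Lc.domain ⊓ (Lw m μ w).domain = Lc.domain
  rw [Lw_domain hw, inf_top_eq]

/-- `z` is an eigenvalue of the unbounded operator `T`. -/
def IsEigenvalue (T : L2 →ₗ.[ℂ] L2) (z : ℂ) : Prop :=
  ∃ u : T.domain, (u : L2) ≠ 0 ∧ T u = z • (u : L2)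

end GPVortex

end

noncomputable section

namespace GPVortex

/-! ### The radial equation: monotonicity near the origin and existence of the maximum. -/

namespace IsVortexProfile

variable {m : ℕ} {μ : ℝ} {w : ℝ → ℝ}

/-! The claim splits into an ODE argument and an energy estimate.

ODE part: with V = m²/r² + r² + 2w² - 2μ the equation reads (r w')' = V r w, so r w' increases
wherever V > 0. Near 0 the centrifugal term makes V positive, and boundedness then rules out w' < 0;
hence w is monotone there and, since it decays at infinity, attains its maximum at some a > 0
(`exists_isMax`). If V were positive just to the right of a, then w would grow past its maximum. As
m²/r² + r² ≥ 2m, this gives w(a)² ≤ μ - m; a second-order expansion at a excludes equality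
(`sq_lt_of_isMax`).

Energy part: pair A u = z u with u and take real parts. The matrix J is skew and commutes with L_c,
so L_c contributes nothing (`re_inner_negJ_Lc`). In -J L_w the multiples of I also drop out, leaving
|w|² times a real symmetric matrix with eigenvalues ±1 (`abs_re_inner_negJ_potential_le`). Thus |Re
z| ≤ max |w|², which is stronger than the bound with the factor 3. -/

theorem hasDerivAt (hw : IsVortexProfile m μ w) {r : ℝ} (hr : 0 < r) :
    HasDerivAt w (deriv w r) r :=
  ((hw.contDiffOn.contDiffAt (Ioi_mem_nhds hr)).differentiableAt (by norm_num)).hasDerivAt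

theorem hasDerivAt_deriv (hw : IsVortexProfile m μ w) {r : ℝ} (hr : 0 < r) :
    HasDerivAt (deriv w) (deriv (deriv w) r) r := by
  have h : ContDiffOn ℝ 1 (deriv w) (Ioi 0) :=
    hw.contDiffOn.deriv_of_isOpen isOpen_Ioi (by norm_num)
  exact ((h.contDiffAt (Ioi_mem_nhds hr)).differentiableAt (by norm_num)).hasDerivAt

/-- The radial equation in divergence form. -/
theorem hasDerivAt_mul_deriv (hw : IsVortexProfile m μ w) {r : ℝ} (hr : 0 < r) :
    HasDerivAt (fun r => r * deriv w r)
      (((m : ℝ) ^ 2 / r ^ 2 + r ^ 2 + 2 * w r ^ 2 - 2 * μ) * (r * w r)) r := by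
  have h0 : HasDerivAt (fun r => r * deriv w r) (1 * deriv w r + r * deriv (deriv w) r) r :=
    (hasDerivAt_id' r).mul (hw.hasDerivAt_deriv hr)
  refine h0.congr_deriv ?_
  have h := hw.ode r hr
  rw [sq_abs] at h
  have h2 : deriv (deriv w) r = - (1 / r * deriv w r) + ((m : ℝ) ^ 2 / r ^ 2 * w r + r ^ 2 * w r
      + 2 * w r ^ 2 * w r - 2 * μ * w r) := by linarith
  rw [h2]
  field_simp
  ring

theorem strictMonoOn_mul_deriv (hw : IsVortexProfile m μ w) {s : Set ℝ} (hs : Convex ℝ s)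
    (hs0 : s ⊆ Ioi 0)
    (hV : ∀ r ∈ interior s, 0 < (m : ℝ) ^ 2 / r ^ 2 + r ^ 2 + 2 * w r ^ 2 - 2 * μ) :
    StrictMonoOn (fun r => r * deriv w r) s := by
  refine strictMonoOn_of_deriv_pos hs
    (fun r hr => (hw.hasDerivAt_mul_deriv (hs0 hr)).continuousAt.continuousWithinAt) ?_
  intro r hr
  have h0 : 0 < r := hs0 (interior_subset hr)
  rw [(hw.hasDerivAt_mul_deriv h0).deriv]
  exact mul_pos (hV r hr) (mul_pos h0 (hw.pos r h0))

/-- If w' were negative at a point near 0, the growth of r w' would give w' ≤ -c/r to the left of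
it, hence logarithmic blow-up at 0, against boundedness. -/
theorem exists_monotoneOn (hw : IsVortexProfile m μ w) (hm : 1 ≤ m) :
    ∃ δ : ℝ, 0 < δ ∧ MonotoneOn w (Ioo 0 δ) := by
  refine ⟨1 / (2 * |μ| + 1), by positivity, ?_⟩
  -- For r < δ ≤ 1 one has 2|μ| r² < 1 ≤ m², so m²/r² alone exceeds 2μ.
  set δ : ℝ := 1 / (2 * |μ| + 1) with hδ
  have hmono := hw.strictMonoOn_mul_deriv (convex_Ioo 0 δ) (fun r hr => hr.1) (by
    rw [interior_Ioo]
    rintro r ⟨h0, h1⟩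
    have hm' : (1 : ℝ) ≤ m := by exact_mod_cast hm
    have hr1 : r * (2 * |μ| + 1) < 1 := (lt_div_iff₀ (by positivity)).1 h1
    have h2 : 2 * |μ| < (m : ℝ) ^ 2 / r ^ 2 := by
      rw [lt_div_iff₀ (by positivity)]
      have := abs_nonneg μ
      have hr2 : r < 1 := by nlinarith
      nlinarith
    have := le_abs_self μ
    nlinarith [sq_nonneg r, sq_nonneg (w r)])
  have hg : ∀ r ∈ Ioo 0 δ, 0 ≤ deriv w r := by
    rintro a ha
    by_contra! hneg
    have hgneg : a * deriv w a < 0 := mul_neg_of_pos_of_neg ha.1 hneg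
    -- On (0, a] the inequality r w' ≤ -c makes w + c log r antitone; since log r → -∞ at 0, w must
    -- exceed any bound `C` there.
    set c : ℝ := -(a * deriv w a) with hc
    have hd : ∀ r ∈ Ioc 0 a,
        HasDerivAt (fun r => w r + c * Real.log r) (deriv w r + c * r⁻¹) r := fun r hr =>
      (hw.hasDerivAt hr.1).add ((Real.hasDerivAt_log hr.1.ne').const_mul c)
    have hanti : AntitoneOn (fun r => w r + c * Real.log r) (Ioc 0 a) := by
      refine antitoneOn_of_deriv_nonpos (convex_Ioc 0 a)
        (fun r hr => (hd r hr).continuousAt.continuousWithinAt)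
        (fun r hr => (hd r (interior_subset hr)).differentiableAt.differentiableWithinAt) ?_
      intro r hr
      have hr' := interior_subset hr
      rw [(hd r hr').deriv]
      have h3 : r * deriv w r ≤ a * deriv w a :=
        hmono.monotoneOn ⟨hr'.1, hr'.2.trans_lt ha.2⟩ ha hr'.2
      have h4 : deriv w r + c * r⁻¹ = (r * deriv w r + c) * r⁻¹ := by
        field_simp [hr'.1.ne']
      rw [h4]
      exact mul_nonpos_of_nonpos_of_nonneg (by linarith) (inv_nonneg.2 hr'.1.le)
    obtain ⟨C, hC⟩ := hw.bounded_zero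
    have hlog : ∀ᶠ r in 𝓝[>] (0 : ℝ), Real.log r < (w a + c * Real.log a - C) / c :=
      Real.tendsto_log_nhdsGT_zero.eventually_lt_atBot _
    obtain ⟨r, ⟨hrC, hrl⟩, hr⟩ :=
      ((hC.and hlog).and (Ioc_mem_nhdsGT ha.1)).exists
    have h5 := hanti hr ⟨ha.1, le_rfl⟩ hr.2
    have hc0 : 0 < c := by linarith
    rw [lt_div_iff₀ hc0] at hrl
    have h6 := (le_abs_self _).trans hrC
    simp only at h5
    linarith
  refine monotoneOn_of_deriv_nonneg (convex_Ioo 0 δ)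
    (fun r hr => (hw.hasDerivAt hr.1).continuousAt.continuousWithinAt)
    (fun r hr => (hw.hasDerivAt (interior_subset hr).1).differentiableAt.differentiableWithinAt) ?_
  exact fun r hr => hg r (interior_subset hr)

/-- A vortex profile attains its maximum. -/
theorem exists_isMax (hw : IsVortexProfile m μ w) (hm : 1 ≤ m) :
    ∃ a : ℝ, 0 < a ∧ ∀ r : ℝ, 0 < r → w r ≤ w a := by
  obtain ⟨δ, hδ, hmono⟩ := hw.exists_monotoneOn hm
  -- The value at δ/2 is the reference: monotonicity keeps w below it to the left, decay keeps w
  -- below it far out, and compactness handles the rest.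
  have hδ2 : 0 < δ / 2 := half_pos hδ
  obtain ⟨b, hb⟩ := eventually_atTop.1
    (hw.tendsto_zero.eventually_lt_const (hw.pos _ hδ2))
  have hne : δ / 2 ∈ Icc (δ / 2) (max b (δ / 2)) := ⟨le_rfl, le_max_right _ _⟩
  obtain ⟨a, ha, hmax⟩ := (isCompact_Icc (a := δ / 2) (b := max b (δ / 2))).exists_isMaxOn
    ⟨_, hne⟩ (hw.contDiffOn.continuousOn.mono fun r hr => lt_of_lt_of_le hδ2 hr.1)
  refine ⟨a, lt_of_lt_of_le hδ2 ha.1, fun r hr => ?_⟩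
  rcases lt_or_ge r (δ / 2) with h | h
  · exact (hmono ⟨hr, by linarith⟩ ⟨hδ2, by linarith⟩ h.le).trans (hmax hne)
  rcases le_total r (max b (δ / 2)) with h' | h'
  · exact hmax ⟨h, h'⟩
  · exact (hb r ((le_max_left _ _).trans h')).le.trans (hmax hne)

/-! ### The strict bound on the maximum. -/

/-- The effective potential cannot be positive immediately to the right of a maximum point. -/
theorem not_pos_right_of_isMax (hw : IsVortexProfile m μ w) {a ε : ℝ} (ha : 0 < a) (hε : 0 < ε)
    (hmax : ∀ r : ℝ, 0 < r → w r ≤ w a) :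
    ¬ ∀ r ∈ Ioo a (a + ε), 0 < (m : ℝ) ^ 2 / r ^ 2 + r ^ 2 + 2 * w r ^ 2 - 2 * μ := by
  intro hV
  have hd0 : deriv w a = 0 := IsLocalMax.deriv_eq_zero
    (by filter_upwards [Ioi_mem_nhds ha] with r hr using hmax r hr)
  -- The function r w' starts from 0 at a and increases strictly, so w' > 0 to the right of a.
  have hg := hw.strictMonoOn_mul_deriv (convex_Ico a (a + ε)) (fun r hr => ha.trans_le hr.1)
    (by rwa [interior_Ico])
  have hs : StrictMonoOn w (Ico a (a + ε)) := by
    refine strictMonoOn_of_deriv_pos (convex_Ico a (a + ε))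
      (fun r hr => (hw.hasDerivAt (ha.trans_le hr.1)).continuousAt.continuousWithinAt) ?_
    rw [interior_Ico]
    intro r hr
    have h := hg ⟨le_rfl, by linarith⟩ ⟨hr.1.le, hr.2⟩ hr.1
    simp only [hd0, mul_zero] at h
    exact pos_of_mul_pos_right h (ha.trans hr.1).le
  have h := hs (a := a) (b := a + ε / 2) ⟨le_rfl, by linarith⟩ ⟨by linarith, by linarith⟩
    (by linarith)
  exact absurd (hmax (a + ε / 2) (by linarith)) (not_le.2 h)

/-- Otherwise V > 0 just to the right of a. This is continuity when V(a) > 0. The degenerate case a²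
= m, w(a)² = μ - m has w'(a) = w''(a) = 0, so w(a) - w(r) = o((r - a)²), which cannot offset (m/r -
r)² ≥ (r - a)². -/
theorem sq_lt_of_isMax (hw : IsVortexProfile m μ w) {a : ℝ} (ha : 0 < a)
    (hmax : ∀ r : ℝ, 0 < r → w r ≤ w a) : w a ^ 2 < μ - m := by
  by_contra! hle
  have hwa := hw.pos a ha
  -- Completing the square: m²/r² + r² = (m/r - r)² + 2m.
  have hV : ∀ r : ℝ, 0 < r → (m : ℝ) ^ 2 / r ^ 2 + r ^ 2 + 2 * w r ^ 2 - 2 * μ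
      = (m / r - r) ^ 2 + 2 * (w r ^ 2 - w a ^ 2) + 2 * (w a ^ 2 - (μ - m)) := by
    intro r hr
    field_simp
    ring
  suffices h : ∃ ε : ℝ, 0 < ε ∧ ∀ r ∈ Ioo a (a + ε),
      0 < (m : ℝ) ^ 2 / r ^ 2 + r ^ 2 + 2 * w r ^ 2 - 2 * μ by
    obtain ⟨ε, hε, h⟩ := h
    exact hw.not_pos_right_of_isMax ha hε hmax h
  suffices h : ∀ᶠ r in 𝓝[>] a, 0 < (m : ℝ) ^ 2 / r ^ 2 + r ^ 2 + 2 * w r ^ 2 - 2 * μ by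
    obtain ⟨b, hb, h⟩ := (mem_nhdsGT_iff_exists_Ioo_subset).1 h
    exact ⟨b - a, sub_pos.2 hb, fun r hr => h ⟨hr.1, by linarith [hr.2]⟩⟩
  by_cases h0 : 0 < (m : ℝ) ^ 2 / a ^ 2 + a ^ 2 + 2 * w a ^ 2 - 2 * μ
  · refine Filter.Eventually.filter_mono nhdsWithin_le_nhds
      (Tendsto.eventually_const_lt h0 (ContinuousAt.tendsto (f := fun r : ℝ =>
        (m : ℝ) ^ 2 / r ^ 2 + r ^ 2 + 2 * w r ^ 2 - 2 * μ) ?_))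
    have := (hw.hasDerivAt ha).continuousAt
    have h3 : a ^ 2 ≠ 0 := by positivity
    fun_prop (disch := assumption)
  -- With V(a) ≤ 0 and w(a)² ≥ μ - m, both nonnegative terms of V(a) vanish.
  have hma : (m / a - a : ℝ) ^ 2 = 0 := by
    have := hV a ha
    nlinarith [sq_nonneg (m / a - a : ℝ)]
  have hm2 : (m : ℝ) = a ^ 2 := by
    have := pow_eq_zero_iff (two_ne_zero) |>.1 hma
    field_simp at this
    linarith
  have hd0 : deriv w a = 0 := IsLocalMax.deriv_eq_zero
    (by filter_upwards [Ioi_mem_nhds ha] with r hr using hmax r hr)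
  have hdd : deriv (deriv w) a = 0 := by
    have h := hw.ode a ha
    have h1 := hV a ha
    rw [hma, sub_self, mul_zero, zero_add, zero_add] at h1
    have h2 : w a ^ 2 - (μ - m) = 0 := by linarith
    rw [h2, mul_zero] at h1
    rw [sq_abs, hd0] at h
    linear_combination -h + w a * h1
  -- This choice gives w(a)² - w(r)² ≤ ε w(a) (r - a)² = (r - a)²/4; doubled in V, it is still only
  -- half of (r - a)².
  set ε : ℝ := 1 / (4 * w a) with hε
  have hε0 : 0 < ε := by positivity
  have hsmall : ∀ᶠ r in 𝓝 a, |deriv w r| ≤ ε * |r - a| := by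
    have h := (hasDerivAt_iff_isLittleO.1 (hw.hasDerivAt_deriv ha)).bound hε0
    filter_upwards [h] with r hr
    simpa [hd0, hdd] using hr
  obtain ⟨d, hd, hsmall⟩ := Metric.eventually_nhds_iff_ball.1 hsmall
  have hD : ∀ r : ℝ, 0 < r → HasDerivAt (fun r => w r + ε / 2 * (r - a) ^ 2)
      (deriv w r + ε * (r - a)) r := by
    intro r hr
    have h0 : HasDerivAt (fun r => w r + ε / 2 * (r - a) ^ 2)
        (deriv w r + ε / 2 * (2 * (r - a) ^ 1 * 1)) r :=
      (hw.hasDerivAt hr).add ((((hasDerivAt_id' r).sub_const a).pow 2).const_mul (ε / 2))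
    exact h0.congr_deriv (by ring)
  have hmono : MonotoneOn (fun r => w r + ε / 2 * (r - a) ^ 2) (Ico a (a + d)) := by
    refine monotoneOn_of_deriv_nonneg (convex_Ico a (a + d))
      (fun r hr => (hD r (ha.trans_le hr.1)).continuousAt.continuousWithinAt)
      (fun r hr => (hD r (ha.trans_le
        (interior_subset hr).1)).differentiableAt.differentiableWithinAt) ?_
    rw [interior_Ico]
    intro r hr
    rw [(hD r (ha.trans hr.1)).deriv]
    have h := hsmall r (by
      rw [Metric.mem_ball, Real.dist_eq, abs_of_pos (sub_pos.2 hr.1)]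
      linarith [hr.2])
    rw [abs_of_pos (sub_pos.2 hr.1)] at h
    linarith [neg_abs_le (deriv w r)]
  filter_upwards [Ioo_mem_nhdsGT (show a < a + d by linarith)] with r hr
  have hr0 : 0 < r := ha.trans hr.1
  have h := hmono (a := a) (b := r) ⟨le_rfl, by linarith⟩ ⟨hr.1.le, hr.2⟩ hr.1.le
  simp only [sub_self] at h
  rw [hV r hr0]
  have h1 : (r - a) ^ 2 ≤ (m / r - r : ℝ) ^ 2 := by
    have : (m / r - r : ℝ) = -((r - a) * ((r + a) / r)) := by
      rw [hm2]
      field_simp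
      ring
    rw [this, neg_sq, mul_pow]
    refine le_mul_of_one_le_right (sq_nonneg _) (one_le_pow₀ ?_)
    rw [le_div_iff₀ hr0]
    linarith
  have hx : 0 < (r - a) ^ 2 := pow_pos (sub_pos.2 hr.1) 2
  have h2 : (w a - w r) * (w a + w r) ≤ (ε / 2 * (r - a) ^ 2) * (2 * w a) :=
    mul_le_mul (by linarith) (by linarith [hmax r hr0]) (by linarith [hw.pos r hr0])
      (by positivity)
  have h3 : (ε / 2 * (r - a) ^ 2) * (2 * w a) = (r - a) ^ 2 / 4 := by
    rw [hε]
    field_simp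
  nlinarith

end IsVortexProfile

/-! ### Constant matrices acting on L² and on the form domain. -/

/-- The constant matrix `M` acting pointwise on `L²(ℝ², ℂ²)`. -/
def actL2 (M : Matrix (Fin 2) (Fin 2) ℂ) : L2 →L[ℂ] L2 :=
  (act M).compLpL 2 (volume : Measure Plane)

theorem coeFn_actL2 (M : Matrix (Fin 2) (Fin 2) ℂ) (u : L2) :
    ∀ᵐ x ∂(volume : Measure Plane), actL2 M u x = act M (u x) :=
  ContinuousLinearMap.coeFn_compLp _ _

/-- The adjoint of -J is J. This moves J onto the test vector, where the weak definition of L_c can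
be used. -/
theorem inner_act_negJ (a b : C2) : inner ℂ a (act (-matJ) b) = inner ℂ (act matJ a) b := by
  simp [matJ, PiLp.inner_apply, Matrix.mulVec, dotProduct, Fin.sum_univ_two]
  ring

theorem re_inner_act_matJ (a : C2) : (inner ℂ (act matJ a) a).re = 0 := by
  simp [matJ, PiLp.inner_apply, Matrix.mulVec, dotProduct, Fin.sum_univ_two]
  ring

theorem inner_actL2_negJ (u v : L2) :
    inner ℂ u (actL2 (-matJ) v) = inner ℂ (actL2 matJ u) v := by
  rw [L2.inner_def, L2.inner_def]
  refine integral_congr_ae ?_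
  filter_upwards [coeFn_actL2 (-matJ) v, coeFn_actL2 matJ u] with x h1 h2
  rw [h1, h2, inner_act_negJ]

theorem re_inner_eq_integral (u v : L2) :
    (inner ℂ u v).re = ∫ x, (inner ℂ (u x) (v x)).re := by
  rw [L2.inner_def]
  exact (integral_re (L2.integrable_inner (𝕜 := ℂ) u v)).symm

theorem re_inner_actL2_matJ (u : L2) : (inner ℂ (actL2 matJ u) u).re = 0 := by
  rw [re_inner_eq_integral]
  refine (integral_congr_ae (g := fun _ => (0 : ℝ)) ?_).trans (by simp)
  filter_upwards [coeFn_actL2 matJ u] with x h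
  rw [h, re_inner_act_matJ]

/-- A constant matrix passes through the integrals against scalar test functions. -/
theorem actL2_mem_weakPartialGraph (M : Matrix (Fin 2) (Fin 2) ℂ) (k : Fin 2) {p : L2 × L2}
    (hp : p ∈ weakPartialGraph k) : (actL2 M p.1, actL2 M p.2) ∈ weakPartialGraph k := by
  intro φ hφ hc
  have key : ∀ ψ : Plane → ℝ, Continuous ψ → HasCompactSupport ψ → ∀ u : L2,
      ∫ x, ψ x • actL2 M u x = act M (∫ x, ψ x • u x) := by
    intro ψ hψ hψc u
    rw [← ContinuousLinearMap.integral_comp_comm _ (integrable_test_smul hψ hψc u)]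
    refine integral_congr_ae ?_
    filter_upwards [coeFn_actL2 M u] with x hx
    rw [hx]
    exact (((act M).restrictScalars ℝ).map_smul _ _).symm
  change ∫ x, partialDeriv k φ x • actL2 M p.1 x = -∫ x, φ x • actL2 M p.2 x
  rw [key _ (testDeriv_continuous k hφ) (testDeriv_compact k hc), key _ hφ.continuous hc,
    hp φ hφ hc, map_neg]

theorem actL2_mem_radiusOp_domain (M : Matrix (Fin 2) (Fin 2) ℂ) {u : L2}
    (hu : u ∈ radiusOp.domain) :
    ∃ h : actL2 M u ∈ radiusOp.domain, radiusOp ⟨actL2 M u, h⟩ = actL2 M (radiusOp ⟨u, hu⟩) := by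
  have hcomm : ∀ (c : ℂ) (y : C2), act (c • (1 : Matrix (Fin 2) (Fin 2) ℂ)) (act M y)
      = act M (act (c • (1 : Matrix (Fin 2) (Fin 2) ℂ)) y) := by
    intro c y
    rw [← mul_apply_eq_comp, ← mul_apply_eq_comp, act, act, ← map_mul,
      ← map_mul]
    simp
  have hu' : MemLp (fun x : Plane => act (((‖x‖ : ℝ) : ℂ) • (1 : Matrix (Fin 2) (Fin 2) ℂ)) (u x))
      2 volume := hu
  have e1 : (fun x => act M (act (((‖x‖ : ℝ) : ℂ) • (1 : Matrix (Fin 2) (Fin 2) ℂ)) (u x)))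
      =ᵐ[(volume : Measure Plane)]
      fun x => act (((‖x‖ : ℝ) : ℂ) • (1 : Matrix (Fin 2) (Fin 2) ℂ)) (actL2 M u x) := by
    filter_upwards [coeFn_actL2 M u] with x hx
    rw [hx, hcomm]
  have h : MemLp (fun x : Plane =>
      act (((‖x‖ : ℝ) : ℂ) • (1 : Matrix (Fin 2) (Fin 2) ℂ)) (actL2 M u x)) 2 volume :=
    MemLp.ae_eq e1 ((act M).comp_memLp' hu')
  refine ⟨h, ?_⟩
  change h.toLp _ = actL2 M (hu'.toLp _)
  refine Lp.ext ?_
  filter_upwards [h.coeFn_toLp, coeFn_actL2 M (hu'.toLp _), hu'.coeFn_toLp, e1] with x h1 h2 h3 h4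
  rw [h1, h2, h3, h4]

theorem mk_gradOn_mem (k : Fin 2) (u : formDomain) :
    ((u : L2), gradOn k u) ∈ weakPartialGraph k := by
  rw [← weakPartial_graph]
  exact (weakPartial k).mem_graph (Submodule.inclusion
    (inf_le_left.trans (iInf_le (fun k => (weakPartial k).domain) k)) u)

theorem weakPartialGraph_ext {k : Fin 2} {u g g' : L2} (h : (u, g) ∈ weakPartialGraph k)
    (h' : (u, g') ∈ weakPartialGraph k) : g = g' := by
  have := weakPartialGraph_unique k _ ((weakPartialGraph k).sub_mem h h') (by simp)
  exact sub_eq_zero.1 this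

theorem actL2_mem_formDomain (M : Matrix (Fin 2) (Fin 2) ℂ) (u : formDomain) :
    actL2 M u ∈ formDomain := by
  refine Submodule.mem_inf.2 ⟨(Submodule.mem_iInf _).2 fun k => ?_,
    (actL2_mem_radiusOp_domain M (Submodule.mem_inf.1 u.2).2).1⟩
  exact Submodule.mem_map.2 ⟨_, actL2_mem_weakPartialGraph M k (mk_gradOn_mem k u), rfl⟩

/-- Both sides are weak derivatives of the same function, so uniqueness identifies them. -/
theorem gradOn_actL2 (M : Matrix (Fin 2) (Fin 2) ℂ) (k : Fin 2) (u : formDomain) :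
    gradOn k ⟨actL2 M u, actL2_mem_formDomain M u⟩ = actL2 M (gradOn k u) :=
  weakPartialGraph_ext (mk_gradOn_mem k ⟨actL2 M u, actL2_mem_formDomain M u⟩)
    (actL2_mem_weakPartialGraph M k (mk_gradOn_mem k u))

theorem radiusOn_actL2 (M : Matrix (Fin 2) (Fin 2) ℂ) (u : formDomain) :
    radiusOn ⟨actL2 M u, actL2_mem_formDomain M u⟩ = actL2 M (radiusOn u) :=
  (actL2_mem_radiusOp_domain M (Submodule.mem_inf.1 u.2).2).2

/-- Since J commutes with ∂ₖ and with |x|, every term has the form ⟨J g, g⟩, which is purely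
imaginary. -/
theorem re_trapForm_actL2_matJ (u : formDomain) :
    (trapForm ⟨actL2 matJ u, actL2_mem_formDomain matJ u⟩ u).re = 0 := by
  have h : ∀ z : ℂ, ((1 / 2 : ℂ) * z).re = 1 / 2 * z.re := by
    intro z
    simp
  simp only [trapForm, gradOn_actL2, radiusOn_actL2, Complex.add_re, h, Complex.re_sum,
    re_inner_actL2_matJ]
  simp

/-! ### The energy estimate for eigenvectors. -/

/-- `-J L_c` is skew-symmetric. -/
theorem re_inner_negJ_Lc (u : Lc.domain) :
    (inner ℂ (u : L2) (actL2 (-matJ) (Lc u))).re = 0 := by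
  have hmem : ((u : L2), Lc u) ∈ LcGraph := by
    rw [← Lc_graph]
    exact Lc.mem_graph u
  obtain ⟨h, hq⟩ := hmem
  rw [inner_actL2_negJ]
  have := hq ⟨actL2 matJ (u : L2), actL2_mem_formDomain matJ ⟨u, h⟩⟩
  rw [← this]
  exact re_trapForm_actL2_matJ ⟨u, h⟩

/-- Only the Hermitian part of -J times the potential matters. The scalar terms 2|w|² - μ sit in its
antisymmetric part and cancel, which is why μ is absent from the bound. -/
theorem abs_re_inner_negJ_potential_le (m : ℕ) (μ : ℝ) (w : ℝ → ℝ) (x : Plane) (y : C2) :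
    |(inner ℂ y (act (-matJ) (act (potential m μ w x) y))).re| ≤ |w ‖x‖| ^ 2 * ‖y‖ ^ 2 := by
  set s := Real.sin (2 * m * angle x) with hs
  set c := Real.cos (2 * m * angle x) with hc
  have hsc : s ^ 2 + c ^ 2 = 1 := Real.sin_sq_add_cos_sq _
  have e : (inner ℂ y (act (-matJ) (act (potential m μ w x) y))).re
      = |w ‖x‖| ^ 2 * (s * ((y 0).re ^ 2 + (y 0).im ^ 2 - (y 1).re ^ 2 - (y 1).im ^ 2)
        - c * (2 * ((y 0).re * (y 1).re + (y 0).im * (y 1).im))) := by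
    have e1 : act (-matJ) (act (potential m μ w x) y) = act (-matJ * potential m μ w x) y := by
      rw [act, act, act, map_mul]
      rfl
    have e2 : -matJ * potential m μ w x
        = !![((|w ‖x‖| ^ 2 * s : ℝ) : ℂ), ((2 * |w ‖x‖| ^ 2 - |w ‖x‖| ^ 2 * c - μ : ℝ) : ℂ);
          ((-(2 * |w ‖x‖| ^ 2 + |w ‖x‖| ^ 2 * c - μ) : ℝ) : ℂ), ((-(|w ‖x‖| ^ 2 * s) : ℝ) : ℂ)] := by
      ext i j
      fin_cases i <;> fin_cases j <;>
        simp [potential, rot, matR, matJ, Matrix.mul_apply, Fin.sum_univ_two, hs, hc,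
          sub_eq_add_neg]
    rw [e1, e2]
    simp only [PiLp.inner_apply, Fin.sum_univ_two, Matrix.ofLp_toEuclideanCLM, Matrix.mulVec,
      dotProduct, Matrix.of_apply, Matrix.cons_val', Matrix.cons_val_zero, Matrix.cons_val_one,
      Matrix.cons_val_fin_one, RCLike.inner_apply, Complex.add_re, Complex.mul_re, Complex.mul_im,
      Complex.add_im, Complex.ofReal_re, Complex.ofReal_im, Complex.conj_re, Complex.conj_im]
    ring
  have en : ‖y‖ ^ 2 = (y 0).re ^ 2 + (y 0).im ^ 2 + (y 1).re ^ 2 + (y 1).im ^ 2 := by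
    rw [EuclideanSpace.norm_sq_eq, Fin.sum_univ_two, Complex.sq_norm, Complex.sq_norm,
      Complex.normSq_apply, Complex.normSq_apply]
    ring
  rw [e, en, abs_mul, abs_of_nonneg (by positivity : 0 ≤ |w ‖x‖| ^ 2)]
  refine mul_le_mul_of_nonneg_left ?_ (by positivity)
  generalize (y 0).re = a
  generalize (y 0).im = b
  generalize (y 1).re = p
  generalize (y 1).im = q
  refine abs_le_of_sq_le_sq ?_ (by positivity)
  set X := a ^ 2 + b ^ 2 - p ^ 2 - q ^ 2 with hX
  set Y := 2 * (a * p + b * q) with hY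
  -- Cauchy–Schwarz for the unit vector (s, c); the defect is (cX + sY)². In the next bound the
  -- defect is 4(aq - bp)².
  have h1 : (s * X - c * Y) ^ 2 ≤ X ^ 2 + Y ^ 2 := by
    nlinarith [sq_nonneg (c * X + s * Y)]
  have h2 : X ^ 2 + Y ^ 2 ≤ (a ^ 2 + b ^ 2 + p ^ 2 + q ^ 2) ^ 2 := by
    nlinarith [sq_nonneg (a * q - b * p)]
  exact h1.trans h2

theorem abs_re_inner_negJ_Lw_le {m : ℕ} {μ : ℝ} {w : ℝ → ℝ} {M : ℝ}
    (hM : ∀ r : ℝ, 0 < r → |w r| ^ 2 ≤ M) (u : (Lw m μ w).domain) :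
    |(inner ℂ (u : L2) (actL2 (-matJ) (Lw m μ w u))).re| ≤ M * ‖(u : L2)‖ ^ 2 := by
  have hn : M * ‖(u : L2)‖ ^ 2 = ∫ x, M * ‖(u : L2) x‖ ^ 2 := by
    rw [integral_const_mul, ← inner_self_eq_norm_sq (𝕜 := ℂ) (u : L2)]
    congr 1
    refine (re_inner_eq_integral _ _).trans (integral_congr_ae (Eventually.of_forall fun x => ?_))
    exact inner_self_eq_norm_sq (𝕜 := ℂ) ((u : L2) x)
  rw [re_inner_eq_integral, hn]
  refine norm_integral_le_of_norm_le (f := fun x =>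
    (inner ℂ ((u : L2) x) (actL2 (-matJ) (Lw m μ w u) x)).re) ?_ ?_
  · exact ((memLp_two_iff_integrable_sq_norm (Lp.aestronglyMeasurable _)).1
      (Lp.memLp (u : L2))).const_mul M
  -- The origin is discarded as a null set, because `hM` controls w only at positive radii.
  · have h0 : ∀ᵐ x ∂(volume : Measure Plane), x ≠ 0 := by
      simp [ae_iff]
    have hu : MemLp (fun x => act (potential m μ w x) ((u : L2) x)) 2 volume := u.2
    filter_upwards [h0, coeFn_actL2 (-matJ) (Lw m μ w u), hu.coeFn_toLp] with x hx h1 h2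
    have h3 : Lw m μ w u x = act (potential m μ w x) ((u : L2) x) := h2
    rw [h1, h3, Real.norm_eq_abs]
    exact (abs_re_inner_negJ_potential_le m μ w x _).trans
      (mul_le_mul_of_nonneg_right (hM _ (norm_pos_iff.2 hx)) (sq_nonneg _))

/-- Eigenvalues of the linearization lie in the strip `|Re z| ≤ sup |w|²`. -/
theorem abs_re_le_of_isEigenvalue {m : ℕ} {μ : ℝ} {w : ℝ → ℝ} {M : ℝ}
    (hM : ∀ r : ℝ, 0 < r → |w r| ^ 2 ≤ M) {z : ℂ}
    (hz : IsEigenvalue (linearization m μ w) z) : |z.re| ≤ M := by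
  obtain ⟨u, hu0, hu⟩ := hz
  have hdom : (u : L2) ∈ Lc.domain ⊓ (Lw m μ w).domain := u.2
  have e : linearization m μ w u = actL2 (-matJ) (Lc ⟨u, hdom.1⟩)
      + actL2 (-matJ) (Lw m μ w ⟨u, hdom.2⟩) := map_add (actL2 (-matJ)) _ _
  have h1 : (inner ℂ (u : L2) (z • (u : L2))).re = z.re * ‖(u : L2)‖ ^ 2 := by
    rw [inner_smul_right, inner_self_eq_norm_sq_to_K]
    simp [← Complex.ofReal_pow]
  have hpos : 0 < ‖(u : L2)‖ ^ 2 := by positivity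
  rw [← hu, e, inner_add_right, Complex.add_re, re_inner_negJ_Lc ⟨u, hdom.1⟩, zero_add] at h1
  have h2 := abs_re_inner_negJ_Lw_le hM (⟨u, hdom.2⟩ : (Lw m μ w).domain)
  simp only at h2
  rw [h1, abs_mul, abs_of_pos hpos] at h2
  exact le_of_mul_le_mul_right h2 hpos

end GPVortex

end

theorem proposition4p4 (m : ℕ) (hm : 1 ≤ m) (μ : ℝ) (w : ℝ → ℝ)
    (hw : GPVortex.IsVortexProfile m μ w) :
    ∃ M : ℝ, IsGreatest {s : ℝ | ∃ r : ℝ, 0 < r ∧ s = |w r| ^ 2} M ∧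
      (∀ z : ℂ, GPVortex.IsEigenvalue (GPVortex.linearization m μ w) z → |z.re| < 3 * M) ∧
      3 * M < 3 * (μ - (m : ℝ)) := by
  obtain ⟨a, ha, hmax⟩ := hw.exists_isMax hm
  have hM : ∀ r : ℝ, 0 < r → |w r| ^ 2 ≤ |w a| ^ 2 := by
    intro r hr
    rw [sq_abs, sq_abs]
    exact pow_le_pow_left₀ (hw.pos r hr).le (hmax r hr) 2
  -- Positivity of the maximum turns |Re z| ≤ M into the strict bound by 3M.
  have hpos : 0 < |w a| ^ 2 := pow_pos (abs_pos.2 (hw.pos a ha).ne') 2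
  refine ⟨|w a| ^ 2, ⟨⟨a, ha, rfl⟩, ?_⟩, fun z hz => ?_, ?_⟩
  · rintro s ⟨r, hr, rfl⟩
    exact hM r hr
  · linarith [GPVortex.abs_re_le_of_isEigenvalue hM hz]
  · rw [sq_abs]
    linarith [hw.sq_lt_of_isMax ha hmax]
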